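/- Let $k\ge 2$ be an integer, and let $\xi$ be a random variable with positive integer values whose tail satisfies $\Pr[\xi\ge \ell]=\Theta(\ell^{-\alpha})$ as $\ell\to\infty$, where $0<\alpha<\frac{k}{k-1}$. Let $\phi$ be a random $k$-CNF over the variables $v_1,\dots,v_n$ drawn from the configuration model $\mathbb{C}_n^k(\xi)$: the degrees $d_1,\dots,d_n$ are sampled independently from $\xi$, and sampled anew until $k$ divides $S_n=d_1+\dots+d_n$; each variable $v_i$ gets $d_i$ clones; the $S_n$ clones are partitioned into $k$-element sets by repeatedly removing $k$ uniformly random clones without replacement; each such set becomes a clause, in which every clone of $v_i$ becomes $v_i$ or $\bar v_i$ with probability $\frac12$ each, independently. Then $\phi$ is unsatisfiable with high probability, that is, $\Pr[\phi\text{ is unsatisfiable}]\to 1$ as $n\to\infty$ through those $n$ for which the model is defined ($\Pr[k \mid S_n]>0$). -/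

import Mathlib

open MeasureTheory ProbabilityTheory Filter Topology
open scoped ENNReal

noncomputable section

namespace ConfigSAT

/-! ### CNF formulas -/

/-- A literal over the variables `v_0, …, v_{n-1}`: `(i, true)` is `v_i`, `(i, false)` is its
negation. -/
abbrev Literal (n : ℕ) : Type := Fin n × Bool

/-- A clause is a multiset of literals: a variable may occur several times in the same clause. -/
abbrev Clause (n : ℕ) : Type := Multiset (Literal n)

/-- A CNF formula over `n` variables is a multiset of clauses. -/
abbrev CNF (n : ℕ) : Type := Multiset (Clause n)

/-- Every set of formulas is an event. -/
instance (n : ℕ) : MeasurableSpace (CNF n) := ⊤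

/-- The formula `φ` has a satisfying assignment: every clause contains a true literal. -/
def Satisfiable {n : ℕ} (φ : CNF n) : Prop :=
  ∃ v : Fin n → Bool, ∀ C ∈ φ, ∃ l ∈ C, v l.1 = l.2

/-! ### Power-law distributions -/

/-- The tail function `F_ξ(ℓ) = Pr[ξ ≥ ℓ]` of a distribution on the natural numbers. -/
def tail (ξ : PMF ℕ) (ℓ : ℕ) : ℝ := (ξ.toMeasure (Set.Ici ℓ)).toReal

/-- `ξ` is a distribution on the positive integers with `F_ξ(ℓ) = Θ(ℓ^{-α})`, where `α > 0`. -/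
structure IsPowerLaw (ξ : PMF ℕ) (α : ℝ) : Prop where
  exponent_pos : 0 < α
  positive : ξ 0 = 0
  tail_isTheta : (fun ℓ : ℕ => tail ξ ℓ) =Θ[atTop] (fun ℓ : ℕ => (ℓ : ℝ) ^ (-α))

/-! ### The configuration model -/

/-- The law of `n` independent samples `d_0, …, d_{n-1}` from `ξ`. -/
def degreeLaw (ξ : PMF ℕ) (n : ℕ) : Measure (Fin n → ℕ) :=
  Measure.pi (fun _ => ξ.toMeasure)

/-- The event that the total degree `S_n = d_0 + ⋯ + d_{n-1}` is a multiple of `k`. -/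
def divisible (k n : ℕ) : Set (Fin n → ℕ) := {d | k ∣ ∑ i, d i}

/-- The clones of the variables: `d i` of them for the variable `v_i`. -/
abbrev Clone {n : ℕ} (d : Fin n → ℕ) : Type := Σ i : Fin n, Fin (d i)

/-- The choices made once the degrees are known: an order in which all the clones are drawn
(without replacement), and a polarity for each clone. -/
abbrev Outcome {n : ℕ} (d : Fin n → ℕ) : Type :=
  (Fin (∑ i, d i) ≃ Clone d) × (Clone d → Bool)

instance {n : ℕ} (d : Fin n → ℕ) : Nonempty (Outcome d) :=
  ⟨(Fintype.equivFinOfCardEq (by simp)).symm, fun _ => true⟩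

/-- The `r`-th position in the `j`-th of the consecutive blocks of `k` positions among `S`. -/
def position (k S : ℕ) (j : Fin (S / k)) (r : Fin k) : Fin S :=
  ⟨j * k + r, by
    calc (j : ℕ) * k + r < j * k + k := Nat.add_lt_add_left r.2 _
      _ = (j + 1) * k := by ring
      _ ≤ S / k * k := Nat.mul_le_mul_right k j.2
      _ ≤ S := Nat.div_mul_le_self S k⟩

/-- The formula produced by an outcome: each block of `k` consecutively drawn clones becomes a
clause, in which every clone is replaced by the literal of its variable with its polarity.
When `k` divides the number of clones, every clone is used exactly once. -/
def Outcome.formula (k : ℕ) {n : ℕ} {d : Fin n → ℕ} (o : Outcome d) : CNF n :=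
  (Finset.univ : Finset (Fin ((∑ i, d i) / k))).val.map fun j =>
    (Finset.univ : Finset (Fin k)).val.map fun r =>
      ((o.1 (position k _ j r)).1, o.2 (o.1 (position k _ j r)))

/-- The law of the random `k`-CNF formula with given degrees `d`: all orders of drawing the clones
and all polarities are equally likely. -/
def formulaLaw (k : ℕ) {n : ℕ} (d : Fin n → ℕ) : PMF (CNF n) :=
  (PMF.uniformOfFintype (Outcome d)).map (Outcome.formula k)

/-- The law of the random `k`-CNF formula over `n` variables in the configuration model. Sampling
the degrees again and again until `k` divides their sum means conditioning their law on this
event (which must have positive probability, see `Feasible`). -/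
def configModel (k : ℕ) (ξ : PMF ℕ) (n : ℕ) : Measure (CNF n) :=
  (cond (degreeLaw ξ n) (divisible k n)).bind fun d => (formulaLaw k d).toMeasure

/-- The sampling procedure can succeed: the sum of `n` degrees is a multiple of `k` with positive
probability. -/
def Feasible (k : ℕ) (ξ : PMF ℕ) (n : ℕ) : Prop := degreeLaw ξ n (divisible k n) ≠ 0

end ConfigSAT

end

/-! One variable of very large degree already refutes the formula. A given clause consists of v_i
with polarity b alone with probability of order (d_i/2S)^k, so the expected number of such clauses
has order d_i^k/S^(k-1). Drawing without replacement makes these events nonpositively correlated,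
and Chebyshev (`card_none_mul_le`) shows that one of them is likely to occur once this ratio is
large. Both polarities then occur, and no value of v_i satisfies both clauses.

Such a variable exists with high probability (`tendsto_degreeLaw_balanced`): some degree reaches n^τ
for any τ < 1/α. Since S may have infinite mean, it is bounded through S^γ ≤ Σ d_i^γ with γ < min(1,
α), which gives S ≤ n^(σ/γ) for any σ > 1. The ratio diverges if τk > (k-1)σ/γ, and α < k/(k-1)
leaves room for that.

Conditioning on k ∣ S costs only a bounded factor: by `exists_le_degreeLaw_divisible` this event has
probability bounded below along the large feasible n. -/

namespace ConfigSAT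

/-! ### Counting bijections with polarities -/

section Counting

variable {X Y : Type*} [Fintype X] [Fintype Y] [DecidableEq X] [DecidableEq Y]

/-- Bijections sending a further point into `A`: the ratio to those that need not. -/
theorem card_equiv_insert_mul (A : Finset Y) (P : Finset X) {x : X} (hx : x ∉ P) :
    (Finset.univ.filter fun e : X ≃ Y => ∀ z ∈ insert x P, e z ∈ A).card *
        (Fintype.card X - P.card) =
      (Finset.univ.filter fun e : X ≃ Y => ∀ z ∈ P, e z ∈ A).card * (A.card - P.card) := by
  classical
  -- Double count pairs (x', e) with x' ∉ P and e x' ∈ A. Swapping x and x' shows that every x'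
  -- contributes equally; every e admits |A| - |P| choices of x'.
  have hdc := Finset.sum_card_bipartiteAbove_eq_sum_card_bipartiteBelow
    (s := Pᶜ) (t := Finset.univ.filter fun e : X ≃ Y => ∀ z ∈ P, e z ∈ A)
    (fun x' e => e x' ∈ A)
  have hl : ∀ x' ∈ Pᶜ, (Finset.bipartiteAbove (fun (x' : X) (e : X ≃ Y) => e x' ∈ A)
      (Finset.univ.filter fun e : X ≃ Y => ∀ z ∈ P, e z ∈ A) x').card =
      (Finset.univ.filter fun e : X ≃ Y => ∀ z ∈ insert x P, e z ∈ A).card := by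
    intro x' hx'
    rw [Finset.mem_compl] at hx'
    have hfix : ∀ z ∈ P, Equiv.swap x x' z = z := fun z hz =>
      Equiv.swap_apply_of_ne_of_ne (fun h => hx (h ▸ hz)) (fun h => hx' (h ▸ hz))
    refine Finset.card_bij' (fun e _ => (Equiv.swap x x').trans e)
      (fun e _ => (Equiv.swap x x').trans e) ?_ ?_ ?_ ?_
    · intro e he
      simp only [Finset.bipartiteAbove, Finset.mem_filter, Finset.mem_univ, true_and] at he
      simp only [Finset.mem_filter, Finset.mem_univ, true_and, Finset.mem_insert,
        forall_eq_or_imp, Equiv.trans_apply, Equiv.swap_apply_left]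
      exact ⟨he.2, fun z hz => by rw [hfix z hz]; exact he.1 z hz⟩
    · intro e he
      simp only [Finset.mem_filter, Finset.mem_univ, true_and, Finset.mem_insert,
        forall_eq_or_imp] at he
      simp only [Finset.bipartiteAbove, Finset.mem_filter, Finset.mem_univ, true_and,
        Equiv.trans_apply, Equiv.swap_apply_right]
      exact ⟨fun z hz => by rw [hfix z hz]; exact he.2 z hz, he.1⟩
    · intro e _; ext z; simp
    · intro e _; ext z; simp
  have hr : ∀ e ∈ (Finset.univ.filter fun e : X ≃ Y => ∀ z ∈ P, e z ∈ A),
      (Finset.bipartiteBelow (fun (x' : X) (e : X ≃ Y) => e x' ∈ A) Pᶜ e).card =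
      A.card - P.card := by
    intro e he
    simp only [Finset.mem_filter, Finset.mem_univ, true_and] at he
    have hsub : P ⊆ A.map e.symm.toEmbedding := fun z hz =>
      Finset.mem_map.2 ⟨e z, he z hz, by simp⟩
    rw [← Finset.card_map e.symm.toEmbedding (s := A), ← Finset.card_sdiff_of_subset hsub]
    congr 1
    ext z
    simp only [Finset.bipartiteBelow, Finset.mem_filter, Finset.mem_compl, Finset.mem_sdiff,
      Finset.mem_map_equiv, Equiv.symm_symm]
    tauto
  rw [Finset.sum_congr rfl hl, Finset.sum_congr rfl hr] at hdc
  simp only [Finset.sum_const, smul_eq_mul, Finset.card_compl] at hdc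
  rw [mul_comm, hdc]

/-- The probability that `p` given positions all receive one of `a` clones among `s`, with a
prescribed polarity. -/
noncomputable def hitProb (a s p : ℕ) : ℝ :=
  ∏ t ∈ Finset.range p, ((a - t : ℕ) : ℝ) / (2 * ((s - t : ℕ) : ℝ))

theorem hitProb_nonneg (a s p : ℕ) : 0 ≤ hitProb a s p :=
  Finset.prod_nonneg fun _ _ => by positivity

/-- The power of 2 cancels the polarity factors built into `hitProb`. -/
theorem card_equiv_mapsTo (A : Finset Y) (P : Finset X) :
    ((Finset.univ.filter fun e : X ≃ Y => ∀ z ∈ P, e z ∈ A).card : ℝ) =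
      Fintype.card (X ≃ Y) * (2 ^ P.card * hitProb A.card (Fintype.card X) P.card) := by
  classical
  induction P using Finset.induction_on with
  | empty => simp only [Finset.notMem_empty, IsEmpty.forall_iff, implies_true,
      Finset.filter_true, Finset.card_univ, hitProb, Finset.card_empty, Finset.range_zero,
      Finset.prod_empty, pow_zero, mul_one]
  | insert x P hx ih =>
    have h := card_equiv_insert_mul A P hx
    have hlt : P.card < Fintype.card X := by
      have := Finset.card_le_univ (insert x P)
      rw [Finset.card_insert_of_notMem hx] at this
      omega
    have hpos : (0 : ℝ) < ((Fintype.card X - P.card : ℕ) : ℝ) := by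
      exact_mod_cast Nat.sub_pos_of_lt hlt
    have h' := congrArg (Nat.cast : ℕ → ℝ) h
    rw [Nat.cast_mul, Nat.cast_mul, ih] at h'
    rw [Finset.card_insert_of_notMem hx, hitProb, Finset.prod_range_succ, ← hitProb,
      eq_div_of_mul_eq hpos.ne' h']
    field_simp
    ring

theorem card_bool_fixed (Q : Finset Y) (b : Bool) :
    ((Finset.univ.filter fun f : Y → Bool => ∀ y ∈ Q, f y = b).card : ℝ) =
      Fintype.card (Y → Bool) / 2 ^ Q.card := by
  classical
  have h : (Finset.univ.filter fun f : Y → Bool => ∀ y ∈ Q, f y = b) =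
      Fintype.piFinset (fun y => if y ∈ Q then ({b} : Finset Bool) else Finset.univ) := by
    ext f
    simp only [Finset.mem_filter, Finset.mem_univ, true_and, Fintype.mem_piFinset]
    refine forall_congr' fun y => ?_
    by_cases hy : y ∈ Q <;> simp [hy]
  have hc : (Qᶜ.card) = Fintype.card Y - Q.card := Finset.card_compl Q
  have hle : Q.card ≤ Fintype.card Y := Finset.card_le_univ Q
  rw [h, Fintype.card_piFinset, eq_div_iff (by positivity)]
  have : ∀ y, (if y ∈ Q then ({b} : Finset Bool) else Finset.univ).card
      = if y ∈ Q then 1 else 2 := fun y => by split_ifs <;> simp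
  simp only [this, Finset.prod_ite, Finset.prod_const, one_pow, one_mul]
  have h2 : (Finset.univ.filter fun y => y ∉ Q) = Qᶜ := by ext; simp
  rw [h2, hc]
  norm_cast
  rw [← pow_add, Nat.sub_add_cancel hle]
  simp

/-- Whatever the bijection, P hits |P| distinct clones, so the polarities always contribute the same
factor 2^(-|P|). -/
theorem card_signed_mapsTo (A : Finset Y) (P : Finset X) (b : Bool) :
    ((Finset.univ.filter fun o : (X ≃ Y) × (Y → Bool) =>
        ∀ z ∈ P, o.1 z ∈ A ∧ o.2 (o.1 z) = b).card : ℝ) =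
      Fintype.card ((X ≃ Y) × (Y → Bool)) * hitProb A.card (Fintype.card X) P.card := by
  classical
  have h1 : (Finset.univ.filter fun o : (X ≃ Y) × (Y → Bool) =>
        ∀ z ∈ P, o.1 z ∈ A ∧ o.2 (o.1 z) = b) =
      ((Finset.univ.filter fun e : X ≃ Y => ∀ z ∈ P, e z ∈ A).sigma
        (fun e => Finset.univ.filter fun f : Y → Bool =>
          ∀ y ∈ P.map e.toEmbedding, f y = b)).map (Equiv.sigmaEquivProd _ _).toEmbedding := by
    ext ⟨e, f⟩
    simp only [Finset.mem_filter, Finset.mem_univ, true_and, Finset.mem_map_equiv,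
      Finset.mem_sigma, Equiv.sigmaEquivProd_symm_apply]
    exact ⟨fun h => ⟨fun z hz => (h z hz).1, fun y hy => by simpa using (h _ hy).2⟩,
      fun h z hz => ⟨h.1 z hz, h.2 (e z) (by simpa using hz)⟩⟩
  rw [h1, Finset.card_map, Finset.card_sigma, Nat.cast_sum]
  simp only [card_bool_fixed, Finset.card_map, Finset.sum_const, nsmul_eq_mul]
  rw [card_equiv_mapsTo, Fintype.card_prod, Nat.cast_mul]
  field_simp

/-- Nonpositive correlation of two disjoint blocks: for a ≤ s the ratio (a - t)/(s - t) decreases in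
t, so the last p factors are at most the first p. -/
theorem hitProb_add_le (a s p : ℕ) (has : a ≤ s) :
    hitProb a s (p + p) ≤ hitProb a s p * hitProb a s p := by
  have h0 := hitProb_nonneg a s p
  rw [hitProb, Finset.prod_range_add, ← hitProb]
  refine mul_le_mul_of_nonneg_left ?_ h0
  refine Finset.prod_le_prod (fun _ _ => by positivity) fun t _ => ?_
  rcases Nat.lt_or_ge (p + t) a with h | h
  · have e1 : ((a - (p + t) : ℕ) : ℝ) = a - (p + t) := by push_cast [Nat.cast_sub h.le]; ring
    have e2 : ((s - (p + t) : ℕ) : ℝ) = s - (p + t) := by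
      push_cast [Nat.cast_sub (h.le.trans has)]; ring
    have e3 : ((a - t : ℕ) : ℝ) = a - t := by
      rw [Nat.cast_sub (by omega)]
    have e4 : ((s - t : ℕ) : ℝ) = s - t := by
      rw [Nat.cast_sub (by omega)]
    rw [e1, e2, e3, e4]
    have h1 : ((p : ℝ) + t) < a := by exact_mod_cast h
    have h2 : (a : ℝ) ≤ s := by exact_mod_cast has
    have h3 : (0 : ℝ) ≤ p := p.cast_nonneg
    rw [div_le_div_iff₀ (by linarith) (by linarith)]
    nlinarith
  -- Here the clones are exhausted, and truncated subtraction makes the factor 0.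
  · rw [Nat.sub_eq_zero_of_le h]
    simp only [Nat.cast_zero, zero_div]
    positivity

/-- At least half of the a clones remain at each draw, so each factor is at least (a/2)/(2s). -/
theorem le_hitProb (a s p : ℕ) (has : a ≤ s) (h : 2 * p ≤ a) (ha : 0 < a) :
    ((a : ℝ) / (4 * s)) ^ p ≤ hitProb a s p := by
  rw [hitProb, Finset.pow_eq_prod_const]
  refine Finset.prod_le_prod (fun _ _ => by positivity) fun t ht => ?_
  rw [Finset.mem_range] at ht
  have e3 : ((a - t : ℕ) : ℝ) = a - t := by
    rw [Nat.cast_sub (by omega)]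
  have e4 : ((s - t : ℕ) : ℝ) = s - t := by
    rw [Nat.cast_sub (by omega)]
  have h1 : 2 * (t : ℝ) ≤ a := by exact_mod_cast (by omega : 2 * t ≤ a)
  have h2 : (a : ℝ) ≤ s := by exact_mod_cast has
  have h3 : (0 : ℝ) < a := by exact_mod_cast ha
  have h4 : (0 : ℝ) ≤ t := t.cast_nonneg
  rw [e3, e4, div_le_div_iff₀ (by linarith) (by linarith)]
  nlinarith

end Counting

/-! ### Second moment method -/

/-- The second moment method for pairwise nonpositively correlated events under a uniform law. -/
theorem card_none_mul_le {Ω J : Type*} [Fintype Ω] [Fintype J] [DecidableEq J] [Nonempty Ω]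
    (E : J → Ω → Prop) [∀ j, DecidablePred (E j)] (q : ℝ)
    (h1 : ∀ j, ((Finset.univ.filter (E j)).card : ℝ) = Fintype.card Ω * q)
    (h2 : ∀ i j, i ≠ j →
      ((Finset.univ.filter fun ω => E i ω ∧ E j ω).card : ℝ) ≤ Fintype.card Ω * (q * q))
    (hq : 0 ≤ q) :
    ((Finset.univ.filter fun ω => ∀ j, ¬ E j ω).card : ℝ) * (Fintype.card J * q)
      ≤ Fintype.card Ω := by
  classical
  set N : ℝ := (Fintype.card Ω : ℝ) with hN
  have hNpos : 0 < N := by rw [hN]; exact_mod_cast Fintype.card_pos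
  set m : ℝ := (Fintype.card J : ℝ) with hm
  have hm0 : 0 ≤ m := by rw [hm]; positivity
  let I : J → Ω → ℝ := fun j ω => if E j ω then 1 else 0
  have hI1 : ∀ j, ∑ ω, I j ω = N * q := fun j => by
    rw [← h1 j]; simp [I]
  have hI2 : ∀ i j, ∑ ω, I i ω * I j ω ≤ N * (q * q) + if i = j then N * q else 0 := by
    intro i j
    have e : ∑ ω, I i ω * I j ω = ((Finset.univ.filter fun ω => E i ω ∧ E j ω).card : ℝ) := by
      simp [I, ← ite_and, and_comm]
    rw [e]
    split_ifs with hij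
    · subst hij
      simp only [and_self, h1]
      have : 0 ≤ N * (q * q) := by positivity
      linarith
    · simpa using h2 i j hij
  have hX1 : ∑ ω, ∑ j, I j ω = m * (N * q) := by
    rw [Finset.sum_comm]; simp [hI1, hm]
  have hX2 : ∑ ω, (∑ j, I j ω) ^ 2 ≤ m * m * (N * (q * q)) + m * (N * q) := by
    calc ∑ ω, (∑ j, I j ω) ^ 2 = ∑ i, ∑ j, ∑ ω, I i ω * I j ω := by
          simp_rw [sq, Finset.sum_mul_sum]
          rw [Finset.sum_comm]
          refine Finset.sum_congr rfl fun i _ => Finset.sum_comm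
      _ ≤ ∑ i : J, ∑ j : J, (N * (q * q) + if i = j then N * q else 0) :=
          Finset.sum_le_sum fun i _ => Finset.sum_le_sum fun j _ => hI2 i j
      _ = m * m * (N * (q * q)) + m * (N * q) := by
          simp [Finset.sum_add_distrib, hm]; ring
  have hvar : ∑ ω, (∑ j, I j ω - m * q) ^ 2 ≤ m * (N * q) := by
    have : ∑ ω, (∑ j, I j ω - m * q) ^ 2 =
        ∑ ω, (∑ j, I j ω) ^ 2 - 2 * (m * q) * ∑ ω, ∑ j, I j ω + N * (m * q) ^ 2 := by
      simp_rw [sub_sq, Finset.sum_add_distrib, Finset.sum_sub_distrib]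
      rw [Finset.mul_sum]
      simp only [Finset.sum_const, Finset.card_univ, nsmul_eq_mul, ← hN]
      congr 2
      refine Finset.sum_congr rfl fun ω _ => by ring
    rw [this, hX1]
    nlinarith
  -- Chebyshev: where no event occurs, the count deviates from its mean by the full m * q.
  have hlow : ((Finset.univ.filter fun ω => ∀ j, ¬ E j ω).card : ℝ) * (m * q) ^ 2 ≤
      ∑ ω, (∑ j, I j ω - m * q) ^ 2 := by
    rw [← nsmul_eq_mul, ← Finset.sum_const]
    refine (Finset.sum_le_sum fun ω hω => ?_).trans
      (Finset.sum_le_sum_of_subset_of_nonneg (Finset.filter_subset _ _) fun _ _ _ => sq_nonneg _)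
    simp only [Finset.mem_filter, Finset.mem_univ, true_and] at hω
    simp [I, hω]
  rcases (mul_nonneg hm0 hq).eq_or_lt with h | h
  · rw [← h, mul_zero]; exact hNpos.le
  · refine le_of_mul_le_mul_right ?_ h
    calc _ = ((Finset.univ.filter fun ω => ∀ j, ¬ E j ω).card : ℝ) * (m * q) ^ 2 := by ring
      _ ≤ m * (N * q) := hlow.trans hvar
      _ = _ := by ring


/-! ### Clauses made of a single literal -/

theorem position_injective {k S : ℕ} {j j' : Fin (S / k)} {r r' : Fin k}
    (h : position k S j r = position k S j' r') : j = j' ∧ r = r' := by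
  have hk : 0 < k := r.pos
  have h1 : (j : ℕ) * k + r = j' * k + r' := congrArg Fin.val h
  have h2 := congrArg (· / k) h1
  have h3 := congrArg (· % k) h1
  simp only [Nat.add_div_of_dvd_right (Dvd.intro_left _ rfl), Nat.mul_div_cancel _ hk,
    Nat.div_eq_of_lt r.2, Nat.div_eq_of_lt r'.2, add_zero, Nat.mul_add_mod_self_right,
    Nat.mod_eq_of_lt r.2, Nat.mod_eq_of_lt r'.2] at h2 h3
  exact ⟨Fin.ext h2, Fin.ext h3⟩

/-- The positions of the `j`-th block. -/
def block (k S : ℕ) (j : Fin (S / k)) : Finset (Fin S) :=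
  Finset.univ.image (position k S j)

theorem card_block (k S : ℕ) (j : Fin (S / k)) : (block k S j).card = k := by
  rw [block, Finset.card_image_of_injective _ fun r r' h => (position_injective h).2]
  simp

theorem disjoint_block {k S : ℕ} {j j' : Fin (S / k)} (h : j ≠ j') :
    Disjoint (block k S j) (block k S j') := by
  rw [Finset.disjoint_left]
  intro x hx hx'
  simp only [block, Finset.mem_image, Finset.mem_univ, true_and] at hx hx'
  obtain ⟨r, rfl⟩ := hx
  obtain ⟨r', hr'⟩ := hx'
  exact h (position_injective hr').1.symm

/-- The clones of one variable. -/
def clonesOf {n : ℕ} (d : Fin n → ℕ) (i : Fin n) : Finset (Clone d) :=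
  Finset.univ.filter fun c => c.1 = i

theorem card_clonesOf {n : ℕ} (d : Fin n → ℕ) (i : Fin n) : (clonesOf d i).card = d i := by
  have : clonesOf d i = Finset.univ.map (Function.Embedding.sigmaMk (β := fun i => Fin (d i)) i) := by
    ext ⟨j, c⟩
    simp only [clonesOf, Finset.mem_filter, Finset.mem_univ, true_and, Finset.mem_map,
      Function.Embedding.sigmaMk_apply]
    constructor
    · rintro rfl; exact ⟨c, rfl⟩
    · rintro ⟨c', h⟩; exact (congrArg Sigma.fst h).symm
  rw [this]; simp

/-- The `j`-th clause consists of the variable `v_i` with polarity `b` only. -/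
def MonoClause (k : ℕ) {n : ℕ} (d : Fin n → ℕ) (i : Fin n) (b : Bool)
    (j : Fin ((∑ i, d i) / k)) (o : Outcome d) : Prop :=
  ∀ z ∈ block k (∑ i, d i) j, o.1 z ∈ clonesOf d i ∧ o.2 (o.1 z) = b

instance (k : ℕ) {n : ℕ} (d : Fin n → ℕ) (i : Fin n) (b : Bool) (j : Fin ((∑ i, d i) / k)) :
    DecidablePred (MonoClause k d i b j) := fun o => by
  unfold MonoClause; infer_instance

theorem card_no_monoClause_mul_le (k : ℕ) {n : ℕ} (d : Fin n → ℕ) (i : Fin n) (b : Bool) :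
    ((Finset.univ.filter fun o : Outcome d => ∀ j, ¬ MonoClause k d i b j o).card : ℝ) *
        (((∑ i, d i) / k : ℕ) * hitProb (d i) (∑ i, d i) k) ≤ Fintype.card (Outcome d) := by
  have hle : d i ≤ ∑ i, d i := Finset.single_le_sum (fun _ _ => Nat.zero_le _) (Finset.mem_univ i)
  have h := card_none_mul_le (MonoClause k d i b) (hitProb (d i) (∑ i, d i) k) ?_ ?_
    (hitProb_nonneg _ _ _)
  · rw [Fintype.card_fin] at h
    convert h
  · intro j
    have := card_signed_mapsTo (clonesOf d i) (block k (∑ i, d i) j) b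
    rw [card_block, card_clonesOf, Fintype.card_fin] at this
    convert this
    rfl
  · intro j j' hjj
    have := card_signed_mapsTo (clonesOf d i) (block k (∑ i, d i) j ∪ block k (∑ i, d i) j') b
    rw [Finset.card_union_of_disjoint (disjoint_block hjj), card_block, card_block,
      card_clonesOf, Fintype.card_fin] at this
    have e : (Finset.univ.filter fun o : Outcome d =>
        MonoClause k d i b j o ∧ MonoClause k d i b j' o) = Finset.univ.filter fun o : Outcome d =>
        ∀ z ∈ block k (∑ i, d i) j ∪ block k (∑ i, d i) j',
          o.1 z ∈ clonesOf d i ∧ o.2 (o.1 z) = b := by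
      ext o
      simp only [Finset.mem_filter, Finset.mem_univ, true_and, Finset.forall_mem_union]
      rfl
    have e' := congrArg (fun s => (s.card : ℝ)) e
    refine (e'.trans (Eq.trans (by congr!) this)).trans_le ?_
    exact mul_le_mul_of_nonneg_left (hitProb_add_le _ _ _ hle) (Nat.cast_nonneg _)

/-- In a satisfied formula no variable has both a purely positive and a purely negative clause. -/
theorem not_monoClause_of_satisfiable {k n : ℕ} {d : Fin n → ℕ} {o : Outcome d}
    (h : Satisfiable (o.formula k)) (i : Fin n) : ∃ b, ∀ j, ¬ MonoClause k d i b j o := by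
  obtain ⟨v, hv⟩ := h
  -- The polarity that v falsifies.
  refine ⟨!(v i), fun j hj => ?_⟩
  obtain ⟨l, hl, hl'⟩ := hv _ (Multiset.mem_map_of_mem _ (Finset.mem_univ j))
  obtain ⟨r, -, rfl⟩ := Multiset.mem_map.1 hl
  obtain ⟨h1, h2⟩ := hj (position k _ j r) (Finset.mem_image_of_mem _ (Finset.mem_univ r))
  simp only [clonesOf, Finset.mem_filter, Finset.mem_univ, true_and] at h1
  simp only at hl'
  rw [h2, h1] at hl'
  simp at hl'

/-- Satisfiability forces one of the two polarities to have no pure clause; the union bound gives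
the numerator 2. -/
theorem formulaLaw_satisfiable_le (k : ℕ) {n : ℕ} (d : Fin n → ℕ) (i : Fin n)
    (hM : 0 < (((∑ i, d i) / k : ℕ) * hitProb (d i) (∑ i, d i) k : ℝ)) :
    (formulaLaw k d).toMeasure {φ | Satisfiable φ} ≤
      ENNReal.ofReal (2 / (((∑ i, d i) / k : ℕ) * hitProb (d i) (∑ i, d i) k)) := by
  classical
  set M : ℝ := ((∑ i, d i) / k : ℕ) * hitProb (d i) (∑ i, d i) k
  have hN : (0 : ℝ) < Fintype.card (Outcome d) := by exact_mod_cast Fintype.card_pos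
  rw [PMF.toMeasure_apply_eq_toOuterMeasure_apply _ (MeasurableSet.of_discrete), formulaLaw,
    PMF.toOuterMeasure_map_apply, PMF.toOuterMeasure_uniformOfFintype_apply]
  have hsub : (Finset.univ.filter fun o : Outcome d => Satisfiable (o.formula k)) ⊆
      (Finset.univ.filter fun o : Outcome d => ∀ j, ¬ MonoClause k d i true j o) ∪
      (Finset.univ.filter fun o : Outcome d => ∀ j, ¬ MonoClause k d i false j o) := by
    intro o ho
    simp only [Finset.mem_filter, Finset.mem_univ, true_and, Finset.mem_union] at ho ⊢
    obtain ⟨b, hb⟩ := not_monoClause_of_satisfiable ho i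
    cases b
    · exact Or.inr hb
    · exact Or.inl hb
  have hc : (Fintype.card ↑(Outcome.formula k (d := d) ⁻¹' {φ | Satisfiable φ})) =
      (Finset.univ.filter fun o : Outcome d => Satisfiable (o.formula k)).card := by
    rw [Fintype.card_subtype]; rfl
  rw [hc, ← ENNReal.ofReal_natCast, ← ENNReal.ofReal_natCast (Fintype.card _),
    ← ENNReal.ofReal_div_of_pos hN]
  refine ENNReal.ofReal_le_ofReal ?_
  rw [div_le_div_iff₀ hN hM]
  have h1 := card_no_monoClause_mul_le k d i true
  have h2 := card_no_monoClause_mul_le k d i false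
  have h3 : ((Finset.univ.filter fun o : Outcome d => Satisfiable (o.formula k)).card : ℝ) ≤
      (Finset.univ.filter fun o : Outcome d => ∀ j, ¬ MonoClause k d i true j o).card +
      (Finset.univ.filter fun o : Outcome d => ∀ j, ¬ MonoClause k d i false j o).card := by
    exact_mod_cast (Finset.card_le_card hsub).trans (Finset.card_union_le _ _)
  have h4 := mul_le_mul_of_nonneg_right h3 hM.le
  linarith

/-- A variable of large degree makes the formula unsatisfiable with large probability. -/
theorem formulaLaw_satisfiable_le_of_degree {k : ℕ} (hk : 1 ≤ k) {n : ℕ} (d : Fin n → ℕ)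
    (i : Fin n) (hi : 2 * k ≤ d i) {K : ℝ} (hK : 0 < K)
    (h : K * ((∑ i, d i : ℕ) : ℝ) ^ (k - 1) ≤ (d i : ℝ) ^ k) :
    (formulaLaw k d).toMeasure {φ | Satisfiable φ} ≤ ENNReal.ofReal (4 * k * 4 ^ k / K) := by
  have hle : d i ≤ ∑ i, d i := Finset.single_le_sum (fun _ _ => Nat.zero_le _) (Finset.mem_univ i)
  have hq := le_hitProb (d i) (∑ i, d i) k hle hi (by omega)
  set S := ∑ i, d i
  have hS : (0 : ℝ) < S := by exact_mod_cast (by omega : 0 < S)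
  have hk' : (0 : ℝ) < k := by exact_mod_cast hk
  -- Since S ≥ k, rounding down loses at most a factor 2.
  have hdiv : (S : ℝ) / (2 * k) ≤ ((S / k : ℕ) : ℝ) := by
    have h1 : S < k * (S / k + 1) := Nat.lt_mul_div_succ S hk
    have h2 : 1 ≤ S / k := (Nat.one_le_div_iff hk).2 (by omega)
    have h3 : S ≤ (S / k) * (2 * k) := by nlinarith
    rw [div_le_iff₀ (by positivity)]
    exact_mod_cast h3
  have hM : K / (2 * k * 4 ^ k) ≤ (S / k : ℕ) * hitProb (d i) S k := by
    refine le_trans ?_ (mul_le_mul hdiv hq (by positivity) (by positivity))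
    obtain ⟨p, rfl⟩ : ∃ p, k = p + 1 := ⟨k - 1, by omega⟩
    rw [Nat.add_sub_cancel] at h
    calc _ = K * (S : ℝ) ^ p / (2 * ((p + 1 : ℕ) : ℝ) * 4 ^ (p + 1) * S ^ p) := by
          field_simp
      _ ≤ (d i : ℝ) ^ (p + 1) / (2 * ((p + 1 : ℕ) : ℝ) * 4 ^ (p + 1) * S ^ p) := by gcongr
      _ = _ := by rw [div_pow, mul_pow, pow_succ (S : ℝ) p]; field_simp
  have hpos : 0 < K / (2 * k * 4 ^ k) := by positivity
  refine (formulaLaw_satisfiable_le k d i (hpos.trans_le hM)).trans (ENNReal.ofReal_le_ofReal ?_)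
  calc _ ≤ 2 / (K / (2 * k * 4 ^ k)) := by gcongr
    _ = _ := by field_simp; ring


/-! ### The total degree modulo k -/

/-- The law of the sum of `n` samples from `ξ` modulo `k`. -/
noncomputable def residueLaw (k : ℕ) (ξ : PMF ℕ) : ℕ → PMF (ZMod k)
  | 0 => PMF.pure 0
  | n + 1 => ξ.bind fun x => (residueLaw k ξ n).map ((x : ZMod k) + ·)

theorem residueLaw_add (k : ℕ) (ξ : PMF ℕ) (i j : ℕ) :
    residueLaw k ξ (i + j) = (residueLaw k ξ i).bind fun x => (residueLaw k ξ j).map (x + ·) := by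
  induction i with
  | zero =>
    rw [zero_add, residueLaw, PMF.pure_bind]
    simp only [zero_add]
    exact (PMF.map_id _).symm
  | succ i ih =>
    rw [Nat.add_right_comm, residueLaw, residueLaw, ih, PMF.bind_bind]
    congr 1
    ext1 x
    rw [PMF.map_bind, PMF.bind_map]
    congr 1
    ext1 y
    rw [PMF.map_comp, Function.comp_apply]
    congr 1
    ext z
    simp [add_assoc]

theorem map_add_left_apply {G : Type*} [AddCommGroup G] (p : PMF G) (x z : G) :
    p.map (x + ·) z = p (z - x) := by
  classical
  rw [PMF.map_apply, tsum_eq_single (z - x)]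
  · simp
  · intro y hy
    rw [if_neg]
    rintro rfl
    simp at hy

theorem degreeLaw_residue (k : ℕ) (ξ : PMF ℕ) (n : ℕ) (z : ZMod k) :
    degreeLaw ξ n {d | ((∑ i, d i : ℕ) : ZMod k) = z} = residueLaw k ξ n z := by
  classical
  induction n generalizing z with
  | zero =>
    rw [degreeLaw, Measure.pi_of_empty, residueLaw, PMF.pure_apply,
      Measure.dirac_apply' _ MeasurableSet.of_discrete]
    simp [Set.indicator_apply, eq_comm]
  | succ n ih =>
    have hmp := measurePreserving_piFinSuccAbove (fun _ : Fin (n + 1) => ξ.toMeasure) 0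
    have hpre : {d : Fin (n + 1) → ℕ | ((∑ i, d i : ℕ) : ZMod k) = z} =
        (MeasurableEquiv.piFinSuccAbove (fun _ : Fin (n + 1) => ℕ) 0) ⁻¹'
          {p : ℕ × (Fin n → ℕ) | ((∑ i, p.2 i : ℕ) : ZMod k) = z - p.1} := by
      ext d
      simp only [Set.mem_ofPred_eq, Set.mem_preimage, Fin.sum_univ_succ,
        MeasurableEquiv.piFinSuccAbove_apply, Fin.insertNthEquiv_zero, Nat.cast_add]
      rw [eq_sub_iff_add_eq']
      rfl
    rw [degreeLaw, hpre, hmp.measure_preimage MeasurableSet.of_discrete.nullMeasurableSet,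
      Measure.prod_apply MeasurableSet.of_discrete, lintegral_countable', residueLaw,
      PMF.bind_apply]
    refine tsum_congr fun x => ?_
    rw [PMF.toMeasure_apply_singleton _ _ MeasurableSet.of_discrete, map_add_left_apply, ← ih,
      mul_comm]
    rfl

theorem degreeLaw_divisible (k : ℕ) (ξ : PMF ℕ) (n : ℕ) :
    degreeLaw ξ n (divisible k n) = residueLaw k ξ n 0 := by
  rw [← degreeLaw_residue]
  congr 1
  ext d
  exact (ZMod.natCast_eq_zero_iff _ _).symm

theorem add_mem_support_residueLaw {k : ℕ} {ξ : PMF ℕ} {i j : ℕ} {x y : ZMod k}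
    (hx : x ∈ (residueLaw k ξ i).support) (hy : y ∈ (residueLaw k ξ j).support) :
    x + y ∈ (residueLaw k ξ (i + j)).support := by
  rw [residueLaw_add, PMF.mem_support_bind_iff]
  exact ⟨x, hx, (PMF.mem_support_map_iff _ _ _).2 ⟨y, hy, rfl⟩⟩

theorem nsmul_mem_support_residueLaw {k : ℕ} {ξ : PMF ℕ} {i : ℕ} {x : ZMod k}
    (hx : x ∈ (residueLaw k ξ i).support) (m : ℕ) :
    m • x ∈ (residueLaw k ξ (m * i)).support := by
  induction m with
  | zero => simp [residueLaw]
  | succ m ih =>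
    rw [succ_nsmul, Nat.succ_mul]
    exact add_mem_support_residueLaw ih hx

/-- Drawing one value of the support every time gives a sum divisible by k. Padding by such draws
keeps reachable residues reachable. -/
theorem zero_mem_support_residueLaw (k : ℕ) (ξ : PMF ℕ) (L : ℕ) :
    (0 : ZMod k) ∈ (residueLaw k ξ (k * L)).support := by
  obtain ⟨a, ha⟩ := ξ.support_nonempty
  have h1 : (a : ZMod k) ∈ (residueLaw k ξ 1).support := by
    rw [residueLaw, PMF.mem_support_bind_iff]
    exact ⟨a, ha, (PMF.mem_support_map_iff _ _ _).2 ⟨0, by simp [residueLaw], by simp⟩⟩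
  have := nsmul_mem_support_residueLaw h1 (k * L)
  rwa [mul_one, mul_nsmul', nsmul_eq_mul, ZMod.natCast_self, zero_mul] at this

/-- Along the feasible `n`, the total degree is a multiple of `k` with probability bounded away
from zero. -/
theorem exists_le_degreeLaw_divisible (k : ℕ) (hk : 1 ≤ k) (ξ : PMF ℕ) :
    ∃ c : ℝ≥0∞, 0 < c ∧ ∃ N, ∀ n ≥ N, Feasible k ξ n → c ≤ degreeLaw ξ n (divisible k n) := by
  classical
  have : NeZero k := ⟨by omega⟩
  -- Only finitely many residues exist, so a single L₀ serves for all that are reachable in some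
  -- multiple of k draws.
  have hL : ∀ z : ZMod k, ∃ L, ∀ L', z ∈ (residueLaw k ξ (k * L')).support →
      z ∈ (residueLaw k ξ (k * L)).support := fun z => by
    by_cases h : ∃ L', z ∈ (residueLaw k ξ (k * L')).support
    · obtain ⟨L, h⟩ := h
      exact ⟨L, fun _ _ => h⟩
    · exact ⟨0, fun L' h' => (h ⟨L', h'⟩).elim⟩
  choose L hL using hL
  set L₀ := ∑ z, L z
  have hL₀ : ∀ z L', z ∈ (residueLaw k ξ (k * L')).support →
      z ∈ (residueLaw k ξ (k * L₀)).support := by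
    intro z L' h
    have hle : L z ≤ L₀ := Finset.single_le_sum (fun _ _ => Nat.zero_le _) (Finset.mem_univ z)
    have := add_mem_support_residueLaw (hL z L' h) (zero_mem_support_residueLaw k ξ (L₀ - L z))
    rwa [add_zero, ← mul_add, Nat.add_sub_cancel' hle] at this
  set q := residueLaw k ξ (k * L₀) with hq
  refine ⟨(Finset.univ.filter fun z => z ∈ q.support).inf q, ?_, k * L₀, fun n hn hf => ?_⟩
  · rw [Finset.lt_inf_iff ENNReal.zero_lt_top]
    intro z hz
    exact pos_iff_ne_zero.2 ((PMF.mem_support_iff _ _).1 (Finset.mem_filter.1 hz).2)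
  set c := (Finset.univ.filter fun z => z ∈ q.support).inf q
  rw [Feasible, degreeLaw_divisible] at hf
  rw [degreeLaw_divisible]
  obtain ⟨m, rfl⟩ : ∃ m, n = m + k * L₀ := ⟨n - k * L₀, by omega⟩
  have h0 : (0 : ZMod k) ∈ (residueLaw k ξ (m + k * L₀)).support := hf
  -- The residue -x = (k-1)x + 0 is reached by k-1 blocks of m draws and one feasible block of n
  -- draws, k(m + L₀) draws in all. Hence the last k * L₀ draws cancel x with probability at least
  -- c.
  have key : ∀ x ∈ (residueLaw k ξ m).support, c ≤ q (0 - x) := by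
    intro x hx
    refine Finset.inf_le (Finset.mem_filter.2 ⟨Finset.mem_univ _, ?_⟩)
    have h1 := add_mem_support_residueLaw (nsmul_mem_support_residueLaw hx (k - 1)) h0
    have e1 : (k - 1) • x + 0 = 0 - x := by
      rw [add_zero, zero_sub, eq_neg_iff_add_eq_zero, ← succ_nsmul, Nat.sub_add_cancel hk,
        nsmul_eq_mul, ZMod.natCast_self, zero_mul]
    have e2 : (k - 1) * m + (m + k * L₀) = k * (m + L₀) := by
      obtain ⟨p, rfl⟩ : ∃ p, k = p + 1 := ⟨k - 1, by omega⟩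
      rw [Nat.add_sub_cancel]; ring
    rw [e1, e2] at h1
    exact hL₀ _ _ h1
  rw [residueLaw_add, PMF.bind_apply]
  calc c = ∑' x, residueLaw k ξ m x * c := by
        rw [ENNReal.tsum_mul_right, PMF.tsum_coe, one_mul]
    _ ≤ _ := ENNReal.tsum_le_tsum fun x => by
        rw [map_add_left_apply]
        by_cases hx : x ∈ (residueLaw k ξ m).support
        · gcongr; exact key x hx
        · rw [(PMF.apply_eq_zero_iff _ _).2 hx, zero_mul]; exact zero_le


/-! ### Maximum and sum of power-law degrees -/

instance (ξ : PMF ℕ) (n : ℕ) : IsProbabilityMeasure (degreeLaw ξ n) := by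
  unfold degreeLaw; infer_instance

/-- Discrete layer-cake bound, which turns the γ-th moment into a weighted sum of tails. -/
theorem natCast_rpow_le_sum {γ : ℝ} (hγ0 : 0 < γ) (hγ1 : γ ≤ 1) (x : ℕ) :
    (x : ℝ) ^ γ ≤ ∑ j ∈ Finset.range x, ((j : ℝ) + 1) ^ (γ - 1) := by
  induction x with
  | zero => simp [Real.zero_rpow hγ0.ne']
  | succ x ih =>
    rw [Finset.sum_range_succ]
    refine le_trans ?_ (add_le_add_left ih _)
    push_cast
    have h1 : (0 : ℝ) < (x : ℝ) + 1 := by positivity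
    have h2 : ((x : ℝ) + 1) ^ γ = ((x : ℝ) + 1) ^ (γ - 1) * (x + 1) := by
      rw [← Real.rpow_add_one h1.ne', sub_add_cancel]
    rw [h2, mul_add, mul_one]
    refine add_le_add_left ?_ _
    rcases Nat.eq_zero_or_pos x with rfl | hx
    · simp [Real.zero_rpow hγ0.ne']
    · have hx' : (0 : ℝ) < x := by exact_mod_cast hx
      have h3 : (x : ℝ) ^ γ = (x : ℝ) ^ (γ - 1) * x := by
        rw [← Real.rpow_add_one hx'.ne', sub_add_cancel]
      rw [h3]
      refine mul_le_mul_of_nonneg_right ?_ hx'.le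
      exact Real.rpow_le_rpow_of_nonpos hx' (by linarith) (by linarith)

theorem tail_le_one (ξ : PMF ℕ) (ℓ : ℕ) : tail ξ ℓ ≤ 1 :=
  measureReal_le_one

theorem tail_nonneg (ξ : PMF ℕ) (ℓ : ℕ) : 0 ≤ tail ξ ℓ := ENNReal.toReal_nonneg

/-- The `γ`-th moment of a power-law distribution with exponent `α > γ` is finite. -/
theorem IsPowerLaw.lintegral_rpow_ne_top {ξ : PMF ℕ} {α γ : ℝ} (hξ : IsPowerLaw ξ α)
    (hγ0 : 0 < γ) (hγ1 : γ ≤ 1) (hγα : γ < α) :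
    ∫⁻ x, ENNReal.ofReal ((x : ℝ) ^ γ) ∂ξ.toMeasure ≠ ∞ := by
  have h1 : ∀ x : ℕ, ENNReal.ofReal ((x : ℝ) ^ γ) ≤
      ∑' j : ℕ, (Set.Ici (j + 1)).indicator
        (fun _ : ℕ => ENNReal.ofReal (((j : ℝ) + 1) ^ (γ - 1))) x := by
    intro x
    refine (ENNReal.ofReal_le_ofReal (natCast_rpow_le_sum hγ0 hγ1 x)).trans ?_
    rw [ENNReal.ofReal_sum_of_nonneg fun _ _ => by positivity]
    refine le_trans (Finset.sum_le_sum fun j hj => ?_) (ENNReal.sum_le_tsum (Finset.range x))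
    rw [Set.indicator_of_mem]
    exact Finset.mem_range.1 hj
  have h2 : ∫⁻ x, ENNReal.ofReal ((x : ℝ) ^ γ) ∂ξ.toMeasure ≤
      ∑' j : ℕ, ENNReal.ofReal (((j : ℝ) + 1) ^ (γ - 1) * tail ξ (j + 1)) := by
    refine (lintegral_mono h1).trans ?_
    rw [lintegral_tsum fun _ => Measurable.of_discrete.aemeasurable]
    refine ENNReal.tsum_le_tsum fun j => ?_
    rw [lintegral_indicator_const MeasurableSet.of_discrete,
      ENNReal.ofReal_mul (by positivity), tail, ENNReal.ofReal_toReal (measure_ne_top _ _)]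
  refine ne_top_of_le_ne_top ?_ h2
  -- The exponent γ - 1 - α is below -1, hence summable.
  have hO : (fun j : ℕ => ((j : ℝ) + 1) ^ (γ - 1) * tail ξ (j + 1)) =O[atTop]
      (fun j : ℕ => (((j + 1 : ℕ) : ℝ)) ^ (γ - 1 - α)) := by
    have ht := hξ.tail_isTheta.1.comp_tendsto (tendsto_add_atTop_nat 1)
    have := (Asymptotics.isBigO_refl (fun j : ℕ => ((j : ℝ) + 1) ^ (γ - 1)) atTop).mul ht
    refine this.congr_right fun j => ?_
    simp only [Function.comp_apply]
    push_cast
    rw [← Real.rpow_add (by positivity), sub_eq_add_neg _ α]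
  have hs : Summable fun j : ℕ => (((j + 1 : ℕ) : ℝ)) ^ (γ - 1 - α) :=
    (summable_nat_add_iff 1).2 (Real.summable_nat_rpow.2 (by linarith))
  have hs' := summable_of_isBigO_nat hs hO
  rw [← ENNReal.ofReal_tsum_of_nonneg (fun j => mul_nonneg (by positivity) (tail_nonneg _ _)) hs']
  exact ENNReal.ofReal_ne_top

theorem degreeLaw_sum_rpow_ge_le (ξ : PMF ℕ) (n : ℕ) (γ : ℝ) {s : ℝ} (hs : 0 < s) :
    degreeLaw ξ n {d | s ≤ ∑ i, (d i : ℝ) ^ γ} ≤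
      n * (∫⁻ x, ENNReal.ofReal ((x : ℝ) ^ γ) ∂ξ.toMeasure) / ENNReal.ofReal s := by
  have h1 : {d : Fin n → ℕ | s ≤ ∑ i, (d i : ℝ) ^ γ} =
      {d | ENNReal.ofReal s ≤ ∑ i, ENNReal.ofReal ((d i : ℝ) ^ γ)} := by
    ext d
    rw [Set.mem_ofPred_eq, Set.mem_ofPred_eq,
      ← ENNReal.ofReal_sum_of_nonneg fun _ _ => by positivity,
      ENNReal.ofReal_le_ofReal_iff (Finset.sum_nonneg fun _ _ => by positivity)]
  have h2 : ∫⁻ d, ∑ i, ENNReal.ofReal ((d i : ℝ) ^ γ) ∂degreeLaw ξ n =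
      n * ∫⁻ x, ENNReal.ofReal ((x : ℝ) ^ γ) ∂ξ.toMeasure := by
    rw [lintegral_finsetSum _ fun _ _ => Measurable.of_discrete]
    have : ∀ i, ∫⁻ d, ENNReal.ofReal ((d i : ℝ) ^ γ) ∂degreeLaw ξ n =
        ∫⁻ x, ENNReal.ofReal ((x : ℝ) ^ γ) ∂ξ.toMeasure := fun i =>
      (measurePreserving_eval (fun _ : Fin n => ξ.toMeasure) i).lintegral_comp
        (f := fun x : ℕ => ENNReal.ofReal ((x : ℝ) ^ γ)) Measurable.of_discrete
    simp [this]
  rw [h1, ← h2]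
  exact meas_ge_le_lintegral_div Measurable.of_discrete.aemeasurable
    (ENNReal.ofReal_pos.2 hs).ne' ENNReal.ofReal_ne_top

theorem degreeLaw_forall_lt_le (ξ : PMF ℕ) (n t : ℕ) :
    degreeLaw ξ n {d | ∀ i, d i < t} ≤ ENNReal.ofReal (Real.exp (-(n * tail ξ t))) := by
  have h1 : {d : Fin n → ℕ | ∀ i, d i < t} = Set.univ.pi fun _ => (Set.Ici t)ᶜ := by
    ext d; simp
  have h2 : ξ.toMeasure (Set.Ici t)ᶜ = ENNReal.ofReal (1 - tail ξ t) := by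
    rw [prob_compl_eq_one_sub MeasurableSet.of_discrete, ENNReal.ofReal_sub _ (tail_nonneg _ _),
      tail, ENNReal.ofReal_toReal (measure_ne_top _ _), ENNReal.ofReal_one]
  rw [h1, degreeLaw, Measure.pi_pi, Finset.prod_const, h2, Finset.card_univ, Fintype.card_fin,
    ← ENNReal.ofReal_pow (by linarith [tail_le_one ξ t])]
  refine ENNReal.ofReal_le_ofReal ?_
  rw [← mul_neg, Real.exp_nat_mul]
  refine pow_le_pow_left₀ (by linarith [tail_le_one ξ t]) ?_ n
  linarith [Real.add_one_le_exp (-tail ξ t)]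

theorem rpow_sum_natCast_le {ι : Type*} (s : Finset ι) (d : ι → ℕ) {γ : ℝ} (hγ0 : 0 < γ)
    (hγ1 : γ ≤ 1) : ((∑ i ∈ s, d i : ℕ) : ℝ) ^ γ ≤ ∑ i ∈ s, (d i : ℝ) ^ γ := by
  classical
  induction s using Finset.induction_on with
  | empty => simp [Real.zero_rpow hγ0.ne']
  | insert a s ha ih =>
    rw [Finset.sum_insert ha, Finset.sum_insert ha, Nat.cast_add]
    exact (Real.rpow_add_le_add_rpow (by positivity) (by positivity) hγ0.le hγ1).trans
      (add_le_add_right ih _)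

/-- The expected number of degrees above the threshold is at least of order n^(1 - τα), which
diverges; the probability of none is at most the exponential of its negative. -/
theorem tendsto_degreeLaw_forall_lt {ξ : PMF ℕ} {α τ : ℝ} (hξ : IsPowerLaw ξ α) (hτ0 : 0 < τ)
    (hτ : τ * α < 1) :
    Tendsto (fun n : ℕ => degreeLaw ξ n {d | ∀ i, d i < ⌈(n : ℝ) ^ τ⌉₊}) atTop (𝓝 0) := by
  obtain ⟨C, hC0, hC⟩ := hξ.tail_isTheta.2.exists_pos
  rw [Asymptotics.isBigOWith_iff] at hC
  have hnτ : Tendsto (fun n : ℕ => (n : ℝ) ^ τ) atTop atTop :=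
    (tendsto_rpow_atTop hτ0).comp tendsto_natCast_atTop_atTop
  have hceil : Tendsto (fun n : ℕ => ⌈(n : ℝ) ^ τ⌉₊) atTop atTop :=
    tendsto_nat_ceil_atTop.comp hnτ
  have hlow : ∀ᶠ n : ℕ in atTop, (C⁻¹ * 2 ^ (-α)) * (n : ℝ) ^ (1 - τ * α) ≤
      n * tail ξ ⌈(n : ℝ) ^ τ⌉₊ := by
    filter_upwards [hceil.eventually hC, hnτ.eventually_ge_atTop 1, eventually_gt_atTop 0]
      with n h1 h2 h3
    have hn : (0 : ℝ) < n := by exact_mod_cast h3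
    have h4 : ((⌈(n : ℝ) ^ τ⌉₊ : ℕ) : ℝ) ≤ 2 * (n : ℝ) ^ τ := by
      have := (Nat.ceil_lt_add_one (zero_le_one.trans h2)).le
      linarith
    have h5 : (0 : ℝ) < ((⌈(n : ℝ) ^ τ⌉₊ : ℕ) : ℝ) := by
      have := Nat.le_ceil ((n : ℝ) ^ τ)
      linarith
    rw [Real.norm_of_nonneg (by positivity), Real.norm_of_nonneg (tail_nonneg _ _)] at h1
    have h6 : (2 * (n : ℝ) ^ τ) ^ (-α) ≤ ((⌈(n : ℝ) ^ τ⌉₊ : ℕ) : ℝ) ^ (-α) :=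
      Real.rpow_le_rpow_of_nonpos h5 h4 (by linarith [hξ.exponent_pos])
    rw [Real.mul_rpow (by norm_num) (by positivity), ← Real.rpow_mul hn.le] at h6
    have h7 : (n : ℝ) ^ (1 - τ * α) = n * (n : ℝ) ^ (τ * -α) := by
      rw [← Real.rpow_one_add' hn.le (by linarith), mul_neg, sub_eq_add_neg]
    rw [h7]
    calc _ = n * (C⁻¹ * (2 ^ (-α) * (n : ℝ) ^ (τ * -α))) := by ring
      _ ≤ n * (C⁻¹ * (C * tail ξ ⌈(n : ℝ) ^ τ⌉₊)) :=
          mul_le_mul_of_nonneg_left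
            (mul_le_mul_of_nonneg_left (h6.trans h1) (by positivity)) hn.le
      _ = _ := by field_simp
  have hinf : Tendsto (fun n : ℕ => n * tail ξ ⌈(n : ℝ) ^ τ⌉₊) atTop atTop :=
    tendsto_atTop_mono' _ hlow (Tendsto.const_mul_atTop (by positivity)
      ((tendsto_rpow_atTop (by linarith)).comp tendsto_natCast_atTop_atTop))
  refine tendsto_of_tendsto_of_tendsto_of_le_of_le tendsto_const_nhds ?_ (fun _ => zero_le)
    (fun n => degreeLaw_forall_lt_le ξ n _)
  rw [← ENNReal.ofReal_zero]
  exact ENNReal.tendsto_ofReal (Real.tendsto_exp_atBot.comp (tendsto_neg_atTop_atBot.comp hinf))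

/-- Markov's inequality: the mean is linear in n, so the bound is of order n^(1 - σ). -/
theorem tendsto_degreeLaw_sum_rpow_ge {ξ : PMF ℕ} {α γ σ : ℝ} (hξ : IsPowerLaw ξ α)
    (hγ0 : 0 < γ) (hγ1 : γ ≤ 1) (hγα : γ < α) (hσ : 1 < σ) :
    Tendsto (fun n : ℕ => degreeLaw ξ n {d | (n : ℝ) ^ σ ≤ ∑ i, (d i : ℝ) ^ γ}) atTop (𝓝 0) := by
  set E := ∫⁻ x, ENNReal.ofReal ((x : ℝ) ^ γ) ∂ξ.toMeasure with hE
  have hEtop : E ≠ ∞ := hξ.lintegral_rpow_ne_top hγ0 hγ1 hγα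
  have hlim : Tendsto (fun n : ℕ => E * ENNReal.ofReal ((n : ℝ) ^ (1 - σ))) atTop (𝓝 0) := by
    have h1 : Tendsto (fun n : ℕ => (n : ℝ) ^ (1 - σ)) atTop (𝓝 0) := by
      have := (tendsto_rpow_neg_atTop (by linarith : 0 < σ - 1)).comp
        (tendsto_natCast_atTop_atTop (R := ℝ))
      simpa [Function.comp_def] using this
    have h2 := ENNReal.Tendsto.const_mul (ENNReal.tendsto_ofReal h1) (Or.inr hEtop)
    simpa using h2
  refine tendsto_of_tendsto_of_tendsto_of_le_of_le' tendsto_const_nhds hlim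
    (Eventually.of_forall fun _ => zero_le) ?_
  filter_upwards [eventually_gt_atTop 0] with n hn
  have hn' : (0 : ℝ) < n := by exact_mod_cast hn
  refine (degreeLaw_sum_rpow_ge_le ξ n γ (Real.rpow_pos_of_pos hn' σ)).trans_eq ?_
  rw [← hE, mul_comm, mul_div_assoc, ← ENNReal.ofReal_natCast,
    ← ENNReal.ofReal_div_of_pos (by positivity), Real.rpow_sub hn', Real.rpow_one]

/-- The degree sequences without a dominant variable. -/
def balanced (k n : ℕ) (K : ℝ) : Set (Fin n → ℕ) :=
  {d | ∀ i, ¬ (2 * k ≤ d i ∧ K * ((∑ i, d i : ℕ) : ℝ) ^ (k - 1) ≤ (d i : ℝ) ^ k)}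

theorem tendsto_degreeLaw_balanced {k : ℕ} (hk : 2 ≤ k) {ξ : PMF ℕ} {α : ℝ}
    (hξ : IsPowerLaw ξ α) (hα : α < (k : ℝ) / ((k : ℝ) - 1)) (K : ℝ) :
    Tendsto (fun n : ℕ => degreeLaw ξ n (balanced k n K)) atTop (𝓝 0) := by
  have hα0 := hξ.exponent_pos
  have hk2 : (2 : ℝ) ≤ k := by exact_mod_cast hk
  set r : ℝ := ((k : ℝ) - 1) / k with hr
  have hr0 : 0 < r := div_pos (by linarith) (by linarith)
  have hr1 : r < 1 := (div_lt_one (by linarith)).2 (by linarith)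
  have hkr : (k : ℝ) * r = k - 1 := by rw [hr]; field_simp
  have hrα : r * α < 1 := by
    rw [lt_div_iff₀ (by linarith)] at hα
    have : k * (r * α) < k * 1 := by rw [← mul_assoc, hkr]; linarith
    exact lt_of_mul_lt_mul_left this (by linarith)
  have hrα0 : 0 < r * α := by positivity
  -- With r = (k-1)/k, the bound on α says rα < 1, while rα < α is automatic. This slack then admits
  -- σ and τ.
  obtain ⟨γ, hγ, hγ'⟩ : ∃ γ, r * α < γ ∧ γ < min 1 α :=
    exists_between (lt_min hrα (by nlinarith))
  have hγ0 : 0 < γ := hrα0.trans hγ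
  have hγ1 : γ < 1 := hγ'.trans_le (min_le_left _ _)
  have hγα : γ < α := hγ'.trans_le (min_le_right _ _)
  obtain ⟨σ, hσ, hσ'⟩ : ∃ σ, 1 < σ ∧ σ < γ / (r * α) :=
    exists_between ((one_lt_div hrα0).2 hγ)
  obtain ⟨τ, hτ, hτ'⟩ : ∃ τ, σ / γ * r < τ ∧ τ < 1 / α := by
    refine exists_between ?_
    rw [lt_div_iff₀ hrα0] at hσ'
    rw [lt_div_iff₀ hα0, div_mul_eq_mul_div, div_mul_eq_mul_div, div_lt_one hγ0]
    linarith
  have hτ0 : 0 < τ := lt_trans (by positivity) hτ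
  have hsum := (tendsto_degreeLaw_forall_lt hξ hτ0 ((lt_div_iff₀ hα0).1 hτ')).add
    (tendsto_degreeLaw_sum_rpow_ge hξ hγ0 hγ1.le hγα hσ)
  rw [add_zero] at hsum
  refine tendsto_of_tendsto_of_tendsto_of_le_of_le' tendsto_const_nhds hsum
    (Eventually.of_forall fun _ => zero_le) ?_
  -- The growth exponent of d_i^k/S^(k-1), which must beat the constant K.
  have hexp : 0 < τ * k - σ / γ * (k - 1 : ℕ) := by
    rw [Nat.cast_sub (by omega), Nat.cast_one, ← hkr]
    nlinarith
  have ev1 := ((tendsto_rpow_atTop hτ0).comp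
    (tendsto_natCast_atTop_atTop (R := ℝ))).eventually_ge_atTop ((2 * k : ℕ) : ℝ)
  have ev2 := ((tendsto_rpow_atTop hexp).comp
    (tendsto_natCast_atTop_atTop (R := ℝ))).eventually_ge_atTop |K|
  filter_upwards [ev1, ev2, eventually_gt_atTop 0] with n h1 h2 h3
  have hn : (0 : ℝ) < n := by exact_mod_cast h3
  simp only [Function.comp_apply] at h1 h2
  refine (measure_mono fun d hd => ?_).trans (measure_union_le _ _)
  by_contra hcon
  simp only [Set.mem_union, Set.mem_ofPred_eq, not_or, not_forall, not_lt, not_le] at hcon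
  obtain ⟨⟨i, hi⟩, hS⟩ := hcon
  have hi' : (n : ℝ) ^ τ ≤ d i := Nat.ceil_le.1 hi
  refine hd i ⟨by exact_mod_cast h1.trans hi', ?_⟩
  have hS' : ((∑ i, d i : ℕ) : ℝ) ≤ (n : ℝ) ^ (σ / γ) := by
    rw [div_eq_mul_inv, Real.rpow_mul hn.le]
    exact (Real.le_rpow_inv_iff_of_pos (by positivity) (by positivity) hγ0).2
      ((rpow_sum_natCast_le _ _ hγ0 hγ1.le).trans hS.le)
  calc K * ((∑ i, d i : ℕ) : ℝ) ^ (k - 1)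
      ≤ (n : ℝ) ^ (τ * k - σ / γ * (k - 1 : ℕ)) * ((n : ℝ) ^ (σ / γ)) ^ (k - 1) := by
        gcongr
        exact (le_abs_self K).trans h2
    _ = ((n : ℝ) ^ τ) ^ k := by
        rw [← Real.rpow_natCast, ← Real.rpow_natCast, ← Real.rpow_mul hn.le,
          ← Real.rpow_mul hn.le, ← Real.rpow_add hn, sub_add_cancel]
    _ ≤ (d i : ℝ) ^ k := by gcongr


/-! ### Averaging over the conditioned degrees -/

theorem configModel_apply (k : ℕ) (ξ : PMF ℕ) (n : ℕ) (s : Set (CNF n)) :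
    configModel k ξ n s =
      ∫⁻ d, (formulaLaw k d).toMeasure s ∂cond (degreeLaw ξ n) (divisible k n) :=
  Measure.bind_apply MeasurableSet.of_discrete Measurable.of_discrete.aemeasurable

theorem isProbabilityMeasure_configModel {k : ℕ} {ξ : PMF ℕ} {n : ℕ} (h : Feasible k ξ n) :
    IsProbabilityMeasure (configModel k ξ n) := by
  have := cond_isProbabilityMeasure (μ := degreeLaw ξ n) h
  exact ⟨by rw [configModel_apply]; simp⟩

theorem configModel_satisfiable_le {k : ℕ} (hk : 1 ≤ k) (ξ : PMF ℕ) {n : ℕ}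
    (h : Feasible k ξ n) {K : ℝ} (hK : 0 < K) :
    configModel k ξ n {φ | Satisfiable φ} ≤
      (degreeLaw ξ n (divisible k n))⁻¹ * degreeLaw ξ n (balanced k n K) +
        ENNReal.ofReal (4 * k * 4 ^ k / K) := by
  have := cond_isProbabilityMeasure (μ := degreeLaw ξ n) h
  have hb : ∀ d : Fin n → ℕ, (formulaLaw k d).toMeasure {φ | Satisfiable φ} ≤
      (balanced k n K).indicator (fun _ => 1) d + ENNReal.ofReal (4 * k * 4 ^ k / K) := by
    intro d
    by_cases hd : d ∈ balanced k n K
    · rw [Set.indicator_of_mem hd]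
      exact prob_le_one.trans le_self_add
    · simp only [balanced, Set.mem_ofPred_eq, not_forall, not_not] at hd
      obtain ⟨i, hi, hi'⟩ := hd
      exact (formulaLaw_satisfiable_le_of_degree hk d i hi hK hi').trans le_add_self
  rw [configModel_apply]
  refine (lintegral_mono hb).trans ?_
  rw [lintegral_add_right _ measurable_const, lintegral_const, measure_univ, mul_one,
    lintegral_indicator_const MeasurableSet.of_discrete, one_mul,
    cond_apply MeasurableSet.of_discrete]
  gcongr
  exact Set.inter_subset_right

theorem tendsto_configModel_satisfiable {k : ℕ} (hk : 2 ≤ k) {ξ : PMF ℕ} {α : ℝ}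
    (hξ : IsPowerLaw ξ α) (hα : α < (k : ℝ) / ((k : ℝ) - 1)) :
    Tendsto (fun n : ℕ => configModel k ξ n {φ | Satisfiable φ})
      (atTop ⊓ 𝓟 {n : ℕ | Feasible k ξ n}) (𝓝 0) := by
  rw [ENNReal.tendsto_nhds_zero]
  intro ε hε
  obtain ⟨c, hc, N, hN⟩ := exists_le_degreeLaw_divisible k (by omega) ξ
  have hε2 : 0 < ε / 2 := ENNReal.half_pos hε.ne'
  -- K is fixed before n: it makes the second-moment error small, and then the balanced sequences
  -- vanish as n grows.
  obtain ⟨K, hK, hK0⟩ : ∃ K : ℝ, ENNReal.ofReal (4 * k * 4 ^ k / K) ≤ ε / 2 ∧ 0 < K := by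
    have h1 : Tendsto (fun K : ℝ => ENNReal.ofReal (4 * k * 4 ^ k / K)) atTop (𝓝 0) := by
      rw [← ENNReal.ofReal_zero]
      exact ENNReal.tendsto_ofReal (tendsto_const_nhds.div_atTop tendsto_id)
    exact ((h1.eventually_le_const hε2).and (eventually_gt_atTop 0)).exists
  have h2 : Tendsto (fun n : ℕ => c⁻¹ * degreeLaw ξ n (balanced k n K)) atTop (𝓝 0) := by
    simpa using ENNReal.Tendsto.const_mul (tendsto_degreeLaw_balanced hk hξ hα K)
      (Or.inr (ENNReal.inv_ne_top.2 hc.ne'))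
  rw [eventually_inf_principal]
  filter_upwards [h2.eventually_le_const hε2, eventually_ge_atTop N] with n h3 h4 hf
  calc _ ≤ _ := configModel_satisfiable_le (by omega) ξ hf hK0
    _ ≤ c⁻¹ * degreeLaw ξ n (balanced k n K) + ε / 2 := by
        gcongr
        exact hN n h4 hf
    _ ≤ ε / 2 + ε / 2 := by gcongr
    _ = ε := ENNReal.add_halves ε

end ConfigSAT

/-- Along the numbers `n` of variables for which the configuration model exists, the random `k`-CNF
formula is unsatisfiable with probability tending to `1`. -/
theorem proposition1 (k : ℕ) (hk : 2 ≤ k) (ξ : PMF ℕ) (α : ℝ)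
    (hξ : ConfigSAT.IsPowerLaw ξ α) (hα0 : 0 < α) (hα : α < (k : ℝ) / ((k : ℝ) - 1)) :
    Tendsto (fun n : ℕ => ConfigSAT.configModel k ξ n {φ | ¬ ConfigSAT.Satisfiable φ})
      (atTop ⊓ 𝓟 {n : ℕ | ConfigSAT.Feasible k ξ n}) (𝓝 1) := by
  have h := ENNReal.Tendsto.sub (tendsto_const_nhds (x := (1 : ℝ≥0∞)))
    (ConfigSAT.tendsto_configModel_satisfiable hk hξ hα) (Or.inl ENNReal.one_ne_top)
  rw [tsub_zero] at h
  refine h.congr' ?_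
  rw [EventuallyEq, eventually_inf_principal]
  refine Eventually.of_forall fun n hn => ?_
  have := ConfigSAT.isProbabilityMeasure_configModel hn
  exact (prob_compl_eq_one_sub MeasurableSet.of_discrete).symm
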